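/- Let $\sigma$ be a relational vocabulary (a set, possibly infinite, of relation symbols of finite arity). A $\sigma$-structure $\mathscr A$ is a set $A$, possibly empty or infinite, with a relation $R^{\mathscr A}\subseteq A^n$ for each $n$-ary $R\in\sigma$; morphisms are homomorphisms. Let $k$ be a positive integer. The structure $\mathbb E_k\mathscr A$ has as universe the set of non-empty sequences of length at most $k$ over $A$. With $\varepsilon_{\mathscr A}[a_1,\dots,a_j]=a_j$, the relation $R^{\mathbb E_k\mathscr A}(s_1,\dots,s_n)$ holds iff the $s_i$ are pairwise comparable in the prefix order and $R^{\mathscr A}(\varepsilon_{\mathscr A} s_1,\dots,\varepsilon_{\mathscr A} s_n)$. The coextension of $f:\mathbb E_k\mathscr A\to\mathscr B$ is $f^*[a_1,\dots,a_j]=[b_1,\dots,b_j]$ with $b_i=f[a_1,\dots,a_i]$. This is a comonad in Kleisli form, and a coKleisli morphism from $\mathscr A$ to $\mathscr B$ is a homomorphism $\mathbb E_k\mathscr A\to\mathscr B$. Let $\sigma^+=\sigma\cup\{I\}$ with $I$ a new binary symbol, and let $J\mathscr A$ be the $\sigma^+$-structure extending $\mathscr A$ in which $I$ is the identity relation. The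 coKleisli category of the relative comonad $\mathbb E_k^+$ has as objects the $\sigma$-structures and as morphisms from $\mathscr A$ to $\mathscr B$ the $\sigma^+$-homomorphisms $f:\mathbb E_kJ\mathscr A\to J\mathscr B$ (where $\mathbb E_k$ is formed over $\sigma^+$). The identity of $\mathscr A$ is $\varepsilon_{J\mathscr A}$ and the composite of $f$ followed by $g$ is $g\circ f^*$. Formulas, with equality, are taken in the infinitary logic $\mathcal L_{\infty,\omega}$: conjunctions and disjunctions may range over arbitrary sets. The quantifiers of counting logic are $\exists,\forall,\exists_{\ge m},\exists_{\le m}$ ($m\in\mathbb N$), each contributing $1$ to the quantifier rank; $\exists_{\ge m}x.\,\psi$ (respectively $\exists_{\le m}x.\,\psi$) says that at least (respectively at most) $m$ elements satisfy $\psi$. Existential-positive formulas are those built from atomic formulas, including equations, by conjunction, disjunction and $\exists$. A formula is called finitary if all its conjunctions and disjunctions are finite. **Theorem.** (1) For all $\sigma$-structures $\mathscr A$ and $\mathscr B$, the following are equivalent: (a) $\mathscr A$ and $\mathscr B$ satisfy the same existential-positive sentences of quantifier rank $\le k$; (b) there are homomorphisms $\mathbb E_k\mathscr A\to\mathscr B$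 and $\mathbb E_k\mathscr B\to\mathscr A$; (c) there are coKleisli morphisms for $\mathbb E_k^+$ from $\mathscr A$ to $\mathscr B$ and from $\mathscr B$ to $\mathscr A$. If $\sigma$ is finite, these are also equivalent to (a) restricted to finitary sentences. (2) For all finite $\sigma$-structures $\mathscr A$ and $\mathscr B$, the following are equivalent: (a) $\mathscr A$ and $\mathscr B$ satisfy the same sentences of quantifier rank $\le k$ of counting logic; (b) $\mathscr A$ and $\mathscr B$ satisfy the same finitary sentences of quantifier rank $\le k$ of counting logic; (c) $\mathscr A$ and $\mathscr B$ are isomorphic in the coKleisli category of $\mathbb E_k^+$. -/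

import Mathlib

open CategoryTheory

universe u

namespace GameComonad

/-! ### Relational structures

A relational vocabulary is a first-order language `σ` with `σ.IsRelational` (no function symbols). -/

/-- A `σ`-structure: a set (possibly empty, possibly infinite) with interpretations of the
symbols of `σ`. -/
structure RelStr (σ : FirstOrder.Language.{u, u}) where
  carrier : Type u
  [str : σ.Structure carrier]

attribute [instance] RelStr.str

/-- The category of `σ`-structures and homomorphisms. -/
instance (σ : FirstOrder.Language.{u, u}) : Category (RelStr σ) where
  Hom A B := FirstOrder.Language.Hom σ A.carrier B.carrier
  id A := FirstOrder.Language.Hom.id σ A.carrier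
  comp f g := FirstOrder.Language.Hom.comp g f

theorem RelStr.hom_ext {σ : FirstOrder.Language.{u, u}} {A B : RelStr σ} {f g : A ⟶ B}
    (h : ∀ a, f.toFun a = g.toFun a) : f = g :=
  FirstOrder.Language.Hom.ext h

/-! ### Comonads in Kleisli form and (relative) coKleisli categories -/

/-- A comonad in Kleisli form. Compositions are in diagrammatic order. -/
structure KleisliComonad (D : Type*) [Category D] where
  obj : D → D
  counit : ∀ A, obj A ⟶ A
  coext : ∀ {A B}, (obj A ⟶ B) → (obj A ⟶ obj B)
  coext_counit : ∀ A, coext (counit A) = 𝟙 (obj A)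
  coext_comp_counit : ∀ {A B} (f : obj A ⟶ B), coext f ≫ counit B = f
  coext_coext : ∀ {A B C} (f : obj A ⟶ B) (g : obj B ⟶ C),
    coext (coext f ≫ g) = coext f ≫ coext g

/-- The objects of the coKleisli category of the relative comonad obtained from a comonad `G`
on `D` and a functor `J : C ⥤ D`: they are the objects of `C`. -/
structure RelCokleisli {C D : Type*} [Category C] [Category D]
    (J : C ⥤ D) (G : KleisliComonad D) where
  of : C

/-- The coKleisli category of the relative comonad: a morphism from `A` to `B` is a morphism
`G (J A) ⟶ J B` of `D`, the identity is the counit at `J A`, and the composite of `f` and `g` is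
`g ∘ f^*`. -/
instance {C D : Type*} [Category C] [Category D] (J : C ⥤ D) (G : KleisliComonad D) :
    Category (RelCokleisli J G) where
  Hom A B := G.obj (J.obj A.of) ⟶ J.obj B.of
  id A := G.counit (J.obj A.of)
  comp f g := G.coext f ≫ g
  id_comp f := by
    change G.coext (G.counit _) ≫ f = f
    rw [G.coext_counit, Category.id_comp]
  comp_id f := G.coext_comp_counit f
  assoc f g h := by
    change G.coext (G.coext f ≫ g) ≫ h = G.coext f ≫ (G.coext g ≫ h)
    rw [G.coext_coext, Category.assoc]

/-! ### The Ehrenfeucht–Fraïssé comonad -/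

/-- Non-empty sequences of length at most `k` over `A`. -/
def Play (k : ℕ) (A : Type u) : Type u :=
  {s : List A // s ≠ [] ∧ s.length ≤ k}

namespace Play

variable {k : ℕ} {A B : Type u}

/-- The last element of a non-empty sequence. -/
def last (s : Play k A) : A :=
  s.1.getLast s.2.1

/-- The prefix of length `i + 1` of a sequence of length greater than `i`. -/
def init (s : Play k A) (i : Fin s.1.length) : Play k A :=
  ⟨s.1.take (i + 1), by
    have h := i.2
    have h' := s.2.2
    refine ⟨fun h0 => ?_, ?_⟩
    · have := congrArg List.length h0
      simp only [List.length_take, List.length_nil] at this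
      omega
    · simp only [List.length_take]
      omega⟩

/-- `f^* [a₁, …, a_j] = [b₁, …, b_j]` where `b_i = f [a₁, …, a_i]`. -/
def coext (f : Play k A → B) (s : Play k A) : Play k B :=
  ⟨List.ofFn fun i : Fin s.1.length => f (s.init i), by
    have h := s.2
    constructor
    · intro h0
      have := congrArg List.length h0
      simp only [List.length_ofFn, List.length_nil] at this
      exact h.1 (List.length_eq_zero_iff.mp this)
    · simpa using h.2⟩

@[simp] theorem length_coext (f : Play k A → B) (s : Play k A) :
    (coext f s).1.length = s.1.length := by
  simp [coext]

theorem length_pos (s : Play k A) : 0 < s.1.length :=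
  List.length_pos_of_ne_nil s.2.1

theorem last_eq (s : Play k A) :
    s.last = s.1[s.1.length - 1]'(by have := s.length_pos; omega) :=
  List.getLast_eq_getElem _

theorem init_last (s : Play k A) (i : Fin s.1.length) : (s.init i).last = s.1[i.1] := by
  have h := i.2
  rw [last_eq]
  have hl : (s.init i).1.length = i.1 + 1 := by
    simp only [init, List.length_take]; omega
  simp only [hl]
  simp [init]

theorem last_coext (f : Play k A → B) (s : Play k A) : (coext f s).last = f s := by
  have h := s.length_pos
  rw [last_eq]
  simp only [length_coext]
  simp only [coext, List.getElem_ofFn]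
  congr 1
  apply Subtype.ext
  simp only [init]
  rw [List.take_of_length_le (by omega)]

theorem coext_last (s : Play k A) : coext last s = s := by
  apply Subtype.ext
  apply List.ext_getElem
  · simp
  · intro i h1 h2
    simp only [coext, List.getElem_ofFn]
    exact init_last s ⟨i, h2⟩

theorem coext_init (f : Play k A → B) (s : Play k A) (i : ℕ) (hi : i < s.1.length)
    (hi' : i < (coext f s).1.length) :
    (coext f s).init ⟨i, hi'⟩ = coext f (s.init ⟨i, hi⟩) := by
  apply Subtype.ext
  apply List.ext_getElem
  · simp [coext, init]
  · intro j h1 h2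
    have hj : j < i + 1 := by
      simp only [init, List.length_take] at h1
      omega
    simp only [init, coext, List.getElem_take, List.getElem_ofFn]
    congr 1
    apply Subtype.ext
    simp only [List.take_take]
    congr 1
    omega

theorem coext_coext {C : Type u} (f : Play k A → B) (g : Play k B → C) (s : Play k A) :
    coext (fun t => g (coext f t)) s = coext g (coext f s) := by
  apply Subtype.ext
  apply List.ext_getElem
  · simp
  · intro i h1 h2
    have hi : i < s.1.length := by simpa using h1
    have hi' : i < (coext f s).1.length := by simpa using h1
    have := coext_init f s i hi hi'
    simp only [coext, List.getElem_ofFn]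
    exact congrArg g this.symm

theorem coext_prefix (f : Play k A → B) {s t : Play k A} (h : s.1 <+: t.1) :
    (coext f s).1 <+: (coext f t).1 := by
  have hle : s.1.length ≤ t.1.length := h.length_le
  have hs : s.1 = t.1.take s.1.length := List.prefix_iff_eq_take.mp h
  rw [List.prefix_iff_eq_take]
  apply List.ext_getElem
  · simp [hle]
  · intro i h1 h2
    have hi : i < s.1.length := by simpa using h1
    simp only [coext, List.getElem_take, List.getElem_ofFn]
    congr 1
    apply Subtype.ext
    simp only [init]
    have hi' : min (i + 1) s.1.length = i + 1 := by omega
    calc s.1.take (i + 1) = (t.1.take s.1.length).take (i + 1) := by rw [← hs]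
      _ = t.1.take (i + 1) := by rw [List.take_take, hi']

end Play

/-- The structure `E_k A`: a tuple of sequences is `R`-related iff the sequences are pairwise
comparable in the prefix ordering and their last elements are `R`-related in `A`. -/
instance playStructure (σ : FirstOrder.Language.{u, u}) [σ.IsRelational] (k : ℕ)
    (A : Type u) [σ.Structure A] : σ.Structure (Play k A) where
  funMap f _ := isEmptyElim f
  RelMap R s :=
    (∀ i j, (s i).1 <+: (s j).1 ∨ (s j).1 <+: (s i).1) ∧
      FirstOrder.Language.Structure.RelMap R fun i => (s i).last

/-- The Ehrenfeucht–Fraïssé comonad `E_k`, in Kleisli form. -/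
def EF (σ : FirstOrder.Language.{u, u}) [σ.IsRelational] (k : ℕ) :
    KleisliComonad (RelStr σ) where
  obj A := ⟨Play k A.carrier⟩
  counit A :=
    { toFun := Play.last
      map_fun' := fun f _ => isEmptyElim f
      map_rel' := fun _ _ h => h.2 }
  coext f :=
    { toFun := Play.coext f.toFun
      map_fun' := fun g _ => isEmptyElim g
      map_rel' := fun R s h => by
        refine ⟨fun i j => ?_, ?_⟩
        · exact (h.1 i j).imp (Play.coext_prefix _) (Play.coext_prefix _)
        · simp only [Function.comp_apply, Play.last_coext]
          exact f.map_rel' R s h }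
  coext_counit A := RelStr.hom_ext Play.coext_last
  coext_comp_counit f := RelStr.hom_ext (Play.last_coext f.toFun)
  coext_coext f g := RelStr.hom_ext (Play.coext_coext f.toFun g.toFun)

/-! ### The relative comonad `E_k^+` -/

/-- The only symbol `I` of the vocabulary adjoined to `σ`; it is binary. -/
inductive IdRel : ℕ → Type u
  | I : IdRel 2

/-- The vocabulary `{I}`. -/
def idLang : FirstOrder.Language.{u, u} := ⟨fun _ => PEmpty, IdRel⟩

instance : (idLang.{u}).IsRelational := fun _ => inferInstanceAs (IsEmpty PEmpty)

/-- `I` interpreted as the identity relation. -/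
abbrev idStructure (A : Type u) : (idLang.{u}).Structure A where
  funMap f _ := isEmptyElim f
  RelMap
    | IdRel.I, x => x 0 = x 1

/-- The vocabulary `σ⁺ = σ ∪ {I}`. -/
abbrev plus (σ : FirstOrder.Language.{u, u}) : FirstOrder.Language.{u, u} :=
  σ.sum idLang.{u}

/-- `J A`: the `σ⁺`-structure extending `A` in which `I` is the identity relation. -/
def plusObj {σ : FirstOrder.Language.{u, u}} (A : RelStr σ) : RelStr (plus σ) :=
  letI := idStructure A.carrier
  ⟨A.carrier⟩

/-- The embedding `J` of `σ`-structures into `σ⁺`-structures. -/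
def plusFunctor (σ : FirstOrder.Language.{u, u}) [σ.IsRelational] : RelStr σ ⥤ RelStr (plus σ) where
  obj := plusObj
  map {A B} f :=
    { toFun := f.toFun
      map_fun' := fun g _ => isEmptyElim g
      map_rel' := fun R x h => by
        rcases R with R | R
        · exact f.map_rel' R x h
        · cases R
          exact congrArg f.toFun h }

/-- The coKleisli category of the relative comonad `E_k^+`. -/
abbrev EFPlus (σ : FirstOrder.Language.{u, u}) [σ.IsRelational] (k : ℕ) :=
  RelCokleisli (plusFunctor σ) (EF (plus σ) k)

/-! ### Logic -/

/-- Formulas over a relational vocabulary with free variables `x₀, …, x_{n-1}`, with equality,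
conjunctions and disjunctions of arbitrary families, and counting quantifiers. Quantifiers bind
the variable `x_n`. -/
inductive Fml (σ : FirstOrder.Language.{u, u}) : ℕ → Type (u + 1)
  | rel {n m : ℕ} (R : σ.Relations m) (v : Fin m → Fin n) : Fml σ n
  | eq {n : ℕ} (i j : Fin n) : Fml σ n
  | neg {n : ℕ} (φ : Fml σ n) : Fml σ n
  | conj {n : ℕ} {ι : Type u} (φ : ι → Fml σ n) : Fml σ n
  | disj {n : ℕ} {ι : Type u} (φ : ι → Fml σ n) : Fml σ n
  | ex {n : ℕ} (φ : Fml σ (n + 1)) : Fml σ n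
  | all {n : ℕ} (φ : Fml σ (n + 1)) : Fml σ n
  | exGE {n : ℕ} (m : ℕ) (φ : Fml σ (n + 1)) : Fml σ n
  | exLE {n : ℕ} (m : ℕ) (φ : Fml σ (n + 1)) : Fml σ n

namespace Fml

variable {σ : FirstOrder.Language.{u, u}}

/-- Satisfaction of a formula in `A` under an assignment of its free variables. -/
def Realize (A : Type u) [σ.Structure A] : {n : ℕ} → Fml σ n → (Fin n → A) → Prop
  | _, rel R v, x => FirstOrder.Language.Structure.RelMap R fun i => x (v i)
  | _, eq i j, x => x i = x j
  | _, neg φ, x => ¬ φ.Realize A x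
  | _, conj φ, x => ∀ i, (φ i).Realize A x
  | _, disj φ, x => ∃ i, (φ i).Realize A x
  | _, ex φ, x => ∃ a, φ.Realize A (Fin.snoc x a)
  | _, all φ, x => ∀ a, φ.Realize A (Fin.snoc x a)
  | _, exGE m φ, x => (m : ℕ∞) ≤ {a | φ.Realize A (Fin.snoc x a)}.encard
  | _, exLE m φ, x => {a | φ.Realize A (Fin.snoc x a)}.encard ≤ (m : ℕ∞)

/-- The quantifier rank (`⊤` if there is no finite bound on the nesting of quantifiers). -/
noncomputable def rank : {n : ℕ} → Fml σ n → ℕ∞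
  | _, rel _ _ => 0
  | _, eq _ _ => 0
  | _, neg φ => φ.rank
  | _, conj φ => ⨆ i, (φ i).rank
  | _, disj φ => ⨆ i, (φ i).rank
  | _, ex φ => φ.rank + 1
  | _, all φ => φ.rank + 1
  | _, exGE _ φ => φ.rank + 1
  | _, exLE _ φ => φ.rank + 1

/-- Existential-positive formulas: built from atomic formulas by conjunctions, disjunctions and
existential quantifiers. -/
def ExPos : {n : ℕ} → Fml σ n → Prop
  | _, rel _ _ => True
  | _, eq _ _ => True
  | _, neg _ => False
  | _, conj φ => ∀ i, (φ i).ExPos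
  | _, disj φ => ∀ i, (φ i).ExPos
  | _, ex φ => φ.ExPos
  | _, all _ => False
  | _, exGE _ _ => False
  | _, exLE _ _ => False

/-- Formulas in which all conjunctions and disjunctions are finite. -/
def Finitary : {n : ℕ} → Fml σ n → Prop
  | _, rel _ _ => True
  | _, eq _ _ => True
  | _, neg φ => φ.Finitary
  | _, @conj _ _ ι φ => Finite ι ∧ ∀ i, (φ i).Finitary
  | _, @disj _ _ ι φ => Finite ι ∧ ∀ i, (φ i).Finitary
  | _, ex φ => φ.Finitary
  | _, all φ => φ.Finitary
  | _, exGE _ φ => φ.Finitary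
  | _, exLE _ φ => φ.Finitary

end Fml

/-- The sentence `φ` is true in `A`. -/
def Models {σ : FirstOrder.Language.{u, u}} (A : RelStr σ) (φ : Fml σ 0) : Prop :=
  φ.Realize A.carrier Fin.elim0

/-- `A` and `B` satisfy the same sentences of the logic `L`. -/
def Equivalent {σ : FirstOrder.Language.{u, u}} (L : Set (Fml σ 0)) (A B : RelStr σ) : Prop :=
  ∀ φ ∈ L, Models A φ ↔ Models B φ

/-- Infinitary existential-positive sentences of quantifier rank at most `k`. -/
def exPosLogic (σ : FirstOrder.Language.{u, u}) (k : ℕ) : Set (Fml σ 0) :=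
  {φ | φ.rank ≤ k ∧ φ.ExPos}

/-- First-order existential-positive sentences of quantifier rank at most `k`. -/
def exPosLogicFO (σ : FirstOrder.Language.{u, u}) (k : ℕ) : Set (Fml σ 0) :=
  {φ | φ.rank ≤ k ∧ φ.ExPos ∧ φ.Finitary}

/-- Infinitary sentences with counting quantifiers of quantifier rank at most `k`. -/
def countingLogic (σ : FirstOrder.Language.{u, u}) (k : ℕ) : Set (Fml σ 0) :=
  {φ | φ.rank ≤ k}

/-- First-order sentences with counting quantifiers of quantifier rank at most `k`. -/
def countingLogicFO (σ : FirstOrder.Language.{u, u}) (k : ℕ) : Set (Fml σ 0) :=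
  {φ | φ.rank ≤ k ∧ φ.Finitary}

end GameComonad

namespace GameComonad

open FirstOrder.Language.Structure

/-! ### Games on sets of pairs -/

/-! Logic and morphisms are both compared with games. A position is the set of pairs of elements
chosen so far, and it is legal if it is the graph of a relation-preserving map.

In part (1) both sides amount to `Sim σ k ∅`. A strategy preserves existential-positive formulas
(`Sim.realize`); conversely, the conjunction of all game formulas true of Spoiler's move tells
Duplicator what to answer (`sim_of_gameFml`). Sending a play to Duplicator's last answer is a
coKleisli morphism (`nonempty_hom_of_sim`); conversely, a homomorphism on plays is read as a
strategy that answers repeated moves as before, so that `I` is not needed (`sim_of_hom`).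

In part (2) both sides amount to `BijSim σ k ∅`. A bijection in each round preserves the sizes of
definable sets (`BijSim.realize_iff`); conversely, one formula isolates each type in finite
structures, so counting yields a type-preserving bijection (`bijSim_of_realize_iff`). Playing the
inverse bijections gives the inverse morphism (`nonempty_iso_of_bijSim`); conversely, the answers of
an isomorphism are injective in the last move, hence bijective by finiteness (`bijSim_of_iso`). The
bijection prescribes the answer to a repeated move, and it is `I` that makes it consistent. -/

section Games

variable {σ : FirstOrder.Language.{u, u}} {A B : Type u} [σ.Structure A] [σ.Structure B]

variable (σ) in
/-- A set of pairs is the graph of a partial map that preserves all relations. -/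
def PartialHom (S : Set (A × B)) : Prop :=
  (∀ p ∈ S, ∀ q ∈ S, p.1 = q.1 → p.2 = q.2) ∧
    ∀ {m : ℕ} (R : σ.Relations m) (p : Fin m → A × B), (∀ i, p i ∈ S) →
      RelMap R (fun i => (p i).1) → RelMap R (fun i => (p i).2)

theorem PartialHom.mono {S T : Set (A × B)} (h : PartialHom σ T) (hST : S ⊆ T) :
    PartialHom σ S :=
  ⟨fun p hp q hq => h.1 p (hST hp) q (hST hq), fun R p hp => h.2 R p fun i => hST (hp i)⟩

variable (σ) in
/-- Duplicator can survive `j` further rounds of the existential game from position `S`. -/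
def Sim : ℕ → Set (A × B) → Prop
  | 0, S => PartialHom σ S
  | j + 1, S => PartialHom σ S ∧ ∀ a, ∃ b, Sim j (insert (a, b) S)

variable (σ) in
/-- Duplicator can survive `j` further rounds of the bijection game from position `S`. -/
def BijSim : ℕ → Set (A × B) → Prop
  | 0, S => PartialHom σ S ∧ PartialHom σ (Prod.swap ⁻¹' S)
  | j + 1, S => (PartialHom σ S ∧ PartialHom σ (Prod.swap ⁻¹' S)) ∧
      ∃ e : A ≃ B, ∀ a, BijSim j (insert (a, e a) S)

theorem Sim.partialHom {j : ℕ} {S : Set (A × B)} (h : Sim σ j S) : PartialHom σ S := by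
  cases j with
  | zero => exact h
  | succ j => exact h.1

theorem BijSim.partialHom {j : ℕ} {S : Set (A × B)} (h : BijSim σ j S) :
    PartialHom σ S ∧ PartialHom σ (Prod.swap ⁻¹' S) := by
  cases j with
  | zero => exact h
  | succ j => exact h.1

/-- Binding one more variable corresponds to playing one more round. -/
theorem range_snoc_pair {n : ℕ} (x : Fin n → A) (y : Fin n → B) (a : A) (b : B) :
    Set.range (fun i => ((Fin.snoc x a : Fin (n + 1) → A) i, (Fin.snoc y b : Fin (n + 1) → B) i)) =
      insert (a, b) (Set.range fun i => (x i, y i)) := by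
  ext p
  simp only [Set.mem_range, Set.mem_insert_iff]
  constructor
  · rintro ⟨i, rfl⟩
    induction i using Fin.lastCases with
    | last => left; simp
    | cast i => right; exact ⟨i, by simp⟩
  · rintro (rfl | ⟨i, rfl⟩)
    · exact ⟨Fin.last n, by simp⟩
    · exact ⟨i.castSucc, by simp⟩

theorem exists_of_add_one_le {r : ℕ∞} {j : ℕ} (h : r + 1 ≤ j) : ∃ i, j = i + 1 ∧ r ≤ (i : ℕ) := by
  cases j with
  | zero => simp at h
  | succ i =>
    refine ⟨i, rfl, ?_⟩
    push_cast at h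
    exact (ENat.add_le_add_iff_right ENat.one_ne_top).1 h

theorem Sim.realize {n : ℕ} (φ : Fml σ n) : ∀ {j : ℕ} {x : Fin n → A} {y : Fin n → B},
    φ.ExPos → φ.rank ≤ j → Sim σ j (Set.range fun i => (x i, y i)) →
      φ.Realize A x → φ.Realize B y := by
  induction φ with
  | rel R v =>
    intro j x y _ _ h hx
    exact h.partialHom.2 R (fun i => (x (v i), y (v i))) (fun i => ⟨v i, rfl⟩) hx
  | eq i i' =>
    intro j x y _ _ h hx
    exact h.partialHom.1 (x i, y i) ⟨i, rfl⟩ (x i', y i') ⟨i', rfl⟩ hx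
  | neg φ ih => intro j x y h; exact h.elim
  | conj φ ih =>
    intro j x y he hr h hx i
    exact ih i (he i) ((le_iSup (fun i => (φ i).rank) i).trans hr) h (hx i)
  | disj φ ih =>
    rintro j x y he hr h ⟨i, hi⟩
    exact ⟨i, ih i (he i) ((le_iSup (fun i => (φ i).rank) i).trans hr) h hi⟩
  | ex φ ih =>
    rintro j x y he hr h ⟨a, ha⟩
    obtain ⟨j, rfl, hj⟩ := exists_of_add_one_le hr
    obtain ⟨b, hb⟩ := h.2 a
    refine ⟨b, ih he hj ?_ ha⟩
    rwa [range_snoc_pair]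
  | all φ ih => intro j x y h; exact h.elim
  | exGE m φ ih => intro j x y h; exact h.elim
  | exLE m φ ih => intro j x y h; exact h.elim

theorem BijSim.realize_iff {n : ℕ} (φ : Fml σ n) : ∀ {j : ℕ} {x : Fin n → A} {y : Fin n → B},
    φ.rank ≤ j → BijSim σ j (Set.range fun i => (x i, y i)) →
      (φ.Realize A x ↔ φ.Realize B y) := by
  -- One bijection, independent of the move, matches the two solution sets; this serves all four
  -- quantifiers.
  have key : ∀ {n : ℕ} {φ : Fml σ (n + 1)} {x : Fin n → A} {y : Fin n → B} {j : ℕ},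
      (∀ {j : ℕ} {x : Fin (n + 1) → A} {y : Fin (n + 1) → B}, φ.rank ≤ j →
        BijSim σ j (Set.range fun i => (x i, y i)) → (φ.Realize A x ↔ φ.Realize B y)) →
      φ.rank + 1 ≤ j → BijSim σ j (Set.range fun i => (x i, y i)) →
      ∃ e : A ≃ B, ∀ a, φ.Realize A (Fin.snoc x a) ↔ φ.Realize B (Fin.snoc y (e a)) := by
    intro n φ x y j ih hr h
    obtain ⟨j, rfl, hj⟩ := exists_of_add_one_le hr
    obtain ⟨-, e, he⟩ := h
    refine ⟨e, fun a => ih hj ?_⟩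
    rw [range_snoc_pair]
    exact he a
  have card : ∀ {n : ℕ} {φ : Fml σ (n + 1)} {x : Fin n → A} {y : Fin n → B} (e : A ≃ B),
      (∀ a, φ.Realize A (Fin.snoc x a) ↔ φ.Realize B (Fin.snoc y (e a))) →
      {a | φ.Realize A (Fin.snoc x a)}.encard = {b | φ.Realize B (Fin.snoc y b)}.encard := by
    intro n φ x y e he
    have : {a | φ.Realize A (Fin.snoc x a)} = e ⁻¹' {b | φ.Realize B (Fin.snoc y b)} :=
      Set.ext he
    rw [this, Set.encard_preimage_of_bijective e.bijective]
  induction φ with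
  | rel R v =>
    intro j x y _ h
    exact ⟨h.partialHom.1.2 R (fun i => (x (v i), y (v i))) (fun i => ⟨v i, rfl⟩),
      h.partialHom.2.2 R (fun i => (y (v i), x (v i))) (fun i => ⟨v i, rfl⟩)⟩
  | eq i i' =>
    intro j x y _ h
    exact ⟨h.partialHom.1.1 (x i, y i) ⟨i, rfl⟩ (x i', y i') ⟨i', rfl⟩,
      h.partialHom.2.1 (y i, x i) ⟨i, rfl⟩ (y i', x i') ⟨i', rfl⟩⟩
  | neg φ ih => intro j x y hr h; exact not_congr (ih hr h)
  | conj φ ih =>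
    intro j x y hr h
    exact forall_congr' fun i => ih i ((le_iSup (fun i => (φ i).rank) i).trans hr) h
  | disj φ ih =>
    intro j x y hr h
    exact exists_congr fun i => ih i ((le_iSup (fun i => (φ i).rank) i).trans hr) h
  | ex φ ih =>
    intro j x y hr h
    obtain ⟨e, he⟩ := key ih hr h
    exact e.exists_congr he
  | all φ ih =>
    intro j x y hr h
    obtain ⟨e, he⟩ := key ih hr h
    exact e.forall_congr he
  | exGE m φ ih =>
    intro j x y hr h
    obtain ⟨e, he⟩ := key ih hr h
    simp only [Fml.Realize, card e he]
  | exLE m φ ih =>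
    intro j x y hr h
    obtain ⟨e, he⟩ := key ih hr h
    simp only [Fml.Realize, card e he]

end Games

/-! ### Game formulas -/

section GameFormulas

variable (σ : FirstOrder.Language.{u, u})

/-- Atomic formulas in `n` variables. -/
abbrev AtomIndex (n : ℕ) : Type u :=
  (Σ m, σ.Relations m × (Fin m → Fin n)) ⊕ ULift.{u} (Fin n × Fin n)

/-- Names of the existential-positive formulas that describe the existential game with `j` rounds
on `n`-tuples: atomic formulas and, for `j > 0`, formulas `∃ x. ⋀ S`. -/
def GameIndex : ℕ → ℕ → Type u
  | n, 0 => AtomIndex σ n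
  | n, j + 1 => AtomIndex σ n ⊕ Set (GameIndex (n + 1) j)

variable {σ}

/-- The atomic formula with a given name. -/
def atom {n : ℕ} : AtomIndex σ n → Fml σ n
  | .inl ⟨_, R, v⟩ => .rel R v
  | .inr ij => .eq ij.down.1 ij.down.2

/-- The game formula with a given name. -/
def gameFml : {n j : ℕ} → GameIndex σ n j → Fml σ n
  | _, 0, i => atom i
  | _, _ + 1, .inl i => atom i
  | n, j + 1, .inr S => .ex (.conj fun i : {i : GameIndex σ (n + 1) j // i ∈ S} => gameFml i.1)

theorem rank_atom {n : ℕ} (i : AtomIndex σ n) : (atom i).rank = 0 := by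
  rcases i with ⟨_, _, _⟩ | _ <;> rfl

theorem exPos_atom {n : ℕ} (i : AtomIndex σ n) : (atom i).ExPos := by
  rcases i with ⟨_, _, _⟩ | _ <;> trivial

theorem finitary_atom {n : ℕ} (i : AtomIndex σ n) : (atom i).Finitary := by
  rcases i with ⟨_, _, _⟩ | _ <;> trivial

theorem rank_gameFml : ∀ {j n : ℕ} (i : GameIndex σ n j), (gameFml i).rank ≤ j
  | 0, _, i => (rank_atom i).trans_le bot_le
  | _ + 1, _, .inl i => (rank_atom i).trans_le bot_le
  | j + 1, n, .inr S => by
    simp only [gameFml, Fml.rank, Nat.cast_add, Nat.cast_one]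
    gcongr
    exact iSup_le fun i => rank_gameFml i.1

theorem exPos_gameFml : ∀ {j n : ℕ} (i : GameIndex σ n j), (gameFml i).ExPos
  | 0, _, i => exPos_atom i
  | _ + 1, _, .inl i => exPos_atom i
  | _ + 1, _, .inr _ => fun i => exPos_gameFml i.1

theorem finite_atomIndex [Finite (Σ n, σ.Relations n)] (n : ℕ) : Finite (AtomIndex σ n) := by
  have : ∀ m, Finite (σ.Relations m) := fun m =>
    Finite.of_injective (fun R => (⟨m, R⟩ : Σ n, σ.Relations n)) sigma_mk_injective
  have : Finite (Σ m, σ.Relations m × (Fin m → Fin n)) :=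
    Finite.of_equiv (Σ R : (Σ n, σ.Relations n), (Fin R.1 → Fin n))
      ⟨fun R => ⟨R.1.1, R.1.2, R.2⟩, fun R => ⟨⟨R.1, R.2.1⟩, R.2.2⟩, fun _ => rfl, fun _ => rfl⟩
  infer_instance

/-- Up to naming there are finitely many game formulas over a finite vocabulary, so their
conjunctions are finite and part (1) needs only finitary sentences. -/
theorem finite_gameIndex [Finite (Σ n, σ.Relations n)] :
    ∀ j n : ℕ, Finite (GameIndex σ n j)
  | 0, n => finite_atomIndex n
  | j + 1, n => by
    have := finite_atomIndex (σ := σ) n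
    have := finite_gameIndex j (n + 1)
    exact inferInstanceAs (Finite (AtomIndex σ n ⊕ Set (GameIndex σ (n + 1) j)))

theorem finitary_gameFml [Finite (Σ n, σ.Relations n)] :
    ∀ {j n : ℕ} (i : GameIndex σ n j), (gameFml i).Finitary
  | 0, _, i => finitary_atom i
  | _ + 1, _, .inl i => finitary_atom i
  | j + 1, n, .inr S => by
    have := finite_gameIndex (σ := σ) j (n + 1)
    exact ⟨Subtype.finite, fun i => finitary_gameFml i.1⟩

variable {A B : Type u} [σ.Structure A] [σ.Structure B]

theorem partialHom_of_atom {n : ℕ} {x : Fin n → A} {y : Fin n → B}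
    (h : ∀ i : AtomIndex σ n, (atom i).Realize A x → (atom i).Realize B y) :
    PartialHom σ (Set.range fun i => (x i, y i)) := by
  constructor
  · rintro _ ⟨i, rfl⟩ _ ⟨i', rfl⟩
    exact h (.inr ⟨i, i'⟩)
  · intro m R p hp
    choose v hv using hp
    obtain rfl : (fun i => (x (v i), y (v i))) = p := funext hv
    exact h (.inl ⟨m, R, v⟩)

theorem sim_of_gameFml : ∀ {j n : ℕ} {x : Fin n → A} {y : Fin n → B},
    (∀ i : GameIndex σ n j, (gameFml i).Realize A x → (gameFml i).Realize B y) →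
      Sim σ j (Set.range fun i => (x i, y i))
  | 0, _, _, _, h => partialHom_of_atom h
  | j + 1, n, x, y, h => by
    refine ⟨partialHom_of_atom fun i => h (.inl i), fun a => ?_⟩
    -- The sentence transferred says that some element satisfies every game formula true of `a`; a
    -- witness in `B` is the answer.
    obtain ⟨b, hb⟩ :=
      h (.inr {i : GameIndex σ (n + 1) j | (gameFml i).Realize A (Fin.snoc x a)}) ⟨a, fun i => i.2⟩
    refine ⟨b, ?_⟩
    rw [← range_snoc_pair]
    exact sim_of_gameFml fun i hi => hb ⟨i, hi⟩

end GameFormulas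

/-! ### The bijection game from counting logic -/

section Counting

variable {σ : FirstOrder.Language.{u, u}} {A B : Type u} [σ.Structure A] [σ.Structure B]

theorem exists_equiv_of_encard_fiber {C : Type*} [Finite A] [Finite B] (f : A → C) (g : B → C)
    (h : ∀ c, {a | f a = c}.encard = {b | g b = c}.encard) : ∃ e : A ≃ B, ∀ a, g (e a) = f a := by
  -- Equal finite cardinalities match the fibres one by one; gluing the matchings gives `e`.
  have hc : ∀ c, Nonempty ({a // f a = c} ≃ {b // g b = c}) := fun c =>
    Finite.card_eq.1 (congrArg ENat.toNat (h c))
  refine ⟨(Equiv.sigmaFiberEquiv f).symm.trans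
    ((Equiv.sigmaCongrRight fun c => (hc c).some).trans (Equiv.sigmaFiberEquiv g)), fun a => ?_⟩
  exact ((hc (f a)).some ⟨a, rfl⟩).2

/-- In a finite family of types over a set of formulas closed under negation and finite
conjunction, every type is isolated by a formula. -/
theorem exists_isolating {F : Type*} {Z : Type u} [Finite Z] (r : Z → F → Prop)
    (hneg : ∀ φ, ∃ ψ, ∀ z, r z ψ ↔ ¬ r z φ)
    (hconj : ∀ {ι : Type u} [Finite ι] (φ : ι → F), ∃ ψ, ∀ z, r z ψ ↔ ∀ i, r z (φ i)) (z₀ : Z) :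
    ∃ φ, ∀ z, r z φ ↔ r z = r z₀ := by
  -- One formula, negated if necessary, separates `z₀` from each element of another type; their
  -- conjunction is finite because `Z` is.
  have h : ∀ w : {w // r w ≠ r z₀}, ∃ φ, r z₀ φ ∧ ¬ r w φ := by
    intro w
    obtain ⟨φ, hφ⟩ := Function.ne_iff.1 w.2
    obtain ⟨ψ, hψ⟩ := hneg φ
    by_cases hw : r w φ
    · refine ⟨ψ, (hψ _).2 fun hz => hφ (propext (iff_of_true hw hz)), fun h => (hψ _).1 h hw⟩
    · refine ⟨φ, by_contra fun hz => hφ (propext (iff_of_false hw hz)), hw⟩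
  choose φ hφ hφ' using h
  obtain ⟨ψ, hψ⟩ := hconj φ
  refine ⟨ψ, fun z => ⟨fun hz => by_contra fun hne => hφ' ⟨z, hne⟩ ((hψ z).1 hz ⟨z, hne⟩),
    fun hz => ?_⟩⟩
  rw [hz]
  exact (hψ z₀).2 hφ

theorem bijSim_of_realize_iff [Finite A] [Finite B] : ∀ {j n : ℕ} {x : Fin n → A} {y : Fin n → B},
    (∀ φ : Fml σ n, φ.rank ≤ j → φ.Finitary → (φ.Realize A x ↔ φ.Realize B y)) →
      BijSim σ j (Set.range fun i => (x i, y i)) := by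
  have base : ∀ {j n : ℕ} {x : Fin n → A} {y : Fin n → B},
      (∀ φ : Fml σ n, φ.rank ≤ j → φ.Finitary → (φ.Realize A x ↔ φ.Realize B y)) →
      PartialHom σ (Set.range fun i => (x i, y i)) ∧
        PartialHom σ (Prod.swap ⁻¹' (Set.range fun i => (x i, y i))) := by
    intro j n x y h
    have h' : ∀ i : AtomIndex σ n, (atom i).Realize A x ↔ (atom i).Realize B y := fun i =>
      h _ ((rank_atom i).trans_le bot_le) (finitary_atom i)
    refine ⟨partialHom_of_atom fun i => (h' i).1,
      (partialHom_of_atom fun i => (h' i).2).mono ?_⟩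
    rintro ⟨b, a⟩ ⟨i, hi⟩
    exact ⟨i, congrArg Prod.swap hi⟩
  intro j
  induction j with
  | zero => exact base
  | succ j ih =>
    intro n x y h
    refine ⟨base h, ?_⟩
    -- Types are taken over the disjoint union, so that one formula isolates a type in both
    -- structures at once.
    let r : A ⊕ B → {φ : Fml σ (n + 1) // φ.rank ≤ j ∧ φ.Finitary} → Prop := fun z φ =>
      z.elim (fun a => φ.1.Realize A (Fin.snoc x a)) (fun b => φ.1.Realize B (Fin.snoc y b))
    have iso : ∀ z₀, ∃ φ, ∀ z, r z φ ↔ r z = r z₀ := by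
      refine exists_isolating r (fun φ => ⟨⟨.neg φ.1, φ.2⟩, ?_⟩)
        (fun φ => ⟨⟨.conj fun i => (φ i).1, iSup_le fun i => (φ i).2.1,
          ‹_›, fun i => (φ i).2.2⟩, ?_⟩)
      · rintro (a | b) <;> rfl
      · rintro (a | b) <;> rfl
    have card : ∀ z₀, {a | r (.inl a) = r z₀}.encard = {b | r (.inr b) = r z₀}.encard := by
      intro z₀
      obtain ⟨φ, hφ⟩ := iso z₀
      simp only [← hφ]
      -- The quantifiers `exGE m`, for all `m`, determine the number of realizations.
      refine ENat.eq_of_forall_natCast_le_iff fun m => h (.exGE m φ.1) ?_ φ.2.2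
      simp only [Fml.rank, Nat.cast_add, Nat.cast_one]
      gcongr
      exact φ.2.1
    obtain ⟨e, he⟩ := exists_equiv_of_encard_fiber (fun a => r (.inl a)) (fun b => r (.inr b)) (by
      intro c
      by_cases hc : ∃ z, r z = c
      · obtain ⟨z, rfl⟩ := hc
        exact card z
      · have hA : {a | r (.inl a) = c} = ∅ :=
          Set.eq_empty_of_forall_notMem fun a ha => hc ⟨_, ha⟩
        have hB : {b | r (.inr b) = c} = ∅ :=
          Set.eq_empty_of_forall_notMem fun b hb => hc ⟨_, hb⟩
        rw [hA, hB, Set.encard_empty, Set.encard_empty])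
    refine ⟨e, fun a => ?_⟩
    rw [← range_snoc_pair]
    exact ih fun φ hr hf => Iff.of_eq (congrFun (he a) ⟨φ, hr, hf⟩).symm

end Counting
end GameComonad

namespace GameComonad

open FirstOrder.Language.Structure

/-! ### Strategies -/

section Strategies

variable {σ : FirstOrder.Language.{u, u}} {A B : Type u}

/-- The answers to a sequence of moves, when `e j S` is the answer given in position `S` with `j`
rounds to go. -/
def respond (e : ℕ → Set (A × B) → A → B) : ℕ → Set (A × B) → List A → List B
  | _, _, [] => []
  | j, S, a :: s => e j S a :: respond e (j - 1) (insert (a, e j S a) S) s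

@[simp] theorem length_respond (e : ℕ → Set (A × B) → A → B) (j : ℕ) (S : Set (A × B))
    (s : List A) : (respond e j S s).length = s.length := by
  induction s generalizing j S with
  | nil => rfl
  | cons a s ih => simp [respond, ih]

theorem respond_take (e : ℕ → Set (A × B) → A → B) (j : ℕ) (S : Set (A × B)) (s : List A) (i : ℕ) :
    respond e j S (s.take i) = (respond e j S s).take i := by
  induction s generalizing j S i with
  | nil => simp [respond]
  | cons a s ih => cases i <;> simp [respond, ih]

theorem preimage_swap_insert (a : A) (b : B) (S : Set (A × B)) :
    Prod.swap ⁻¹' (insert (a, b) S) = insert (b, a) (Prod.swap ⁻¹' S) := by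
  ext ⟨b', a'⟩
  simp [and_comm]

theorem respond_symm_respond (e : ℕ → Set (A × B) → A ≃ B) (j : ℕ) (S : Set (A × B)) (s : List A) :
    respond (fun j T => (e j (Prod.swap ⁻¹' T)).symm) j (Prod.swap ⁻¹' S)
      (respond (fun j S => e j S) j S s) = s := by
  induction s generalizing j S with
  | nil => rfl
  | cons a s ih =>
    simp only [respond]
    have h : (e j (Prod.swap ⁻¹' (Prod.swap ⁻¹' S))).symm (e j S a) = a :=
      (e j S).symm_apply_apply a
    rw [h, ← preimage_swap_insert, ih]

theorem respond_respond_symm (e : ℕ → Set (A × B) → A ≃ B) (j : ℕ) (S : Set (A × B)) (s : List B) :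
    respond (fun j S => e j S) j S
      (respond (fun j T => (e j (Prod.swap ⁻¹' T)).symm) j (Prod.swap ⁻¹' S) s) = s :=
  respond_symm_respond (fun j T => (e j (Prod.swap ⁻¹' T)).symm) j (Prod.swap ⁻¹' S) s

/-- `W` is an invariant that the strategy maintains, so the final position is still legal. It is
left abstract to cover `Sim`, `BijSim` and the mirror image of `BijSim`. -/
theorem partialHom_respond [σ.Structure A] [σ.Structure B] {W : ℕ → Set (A × B) → Prop}
    {e : ℕ → Set (A × B) → A → B} (hW : ∀ j S, W j S → PartialHom σ S)
    (he : ∀ j S, W (j + 1) S → ∀ a, W j (insert (a, e (j + 1) S a) S)) (s : List A) :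
    ∀ {j : ℕ} {S : Set (A × B)}, W j S → s.length ≤ j →
      PartialHom σ (S ∪ {p | p ∈ s.zip (respond e j S s)}) := by
  induction s with
  | nil =>
    intro j S h _
    simpa [respond] using hW j S h
  | cons a s ih =>
    intro j S h hs
    obtain ⟨j, rfl⟩ : ∃ i, j = i + 1 := ⟨j - 1, by simp at hs; omega⟩
    refine (ih (he j S h a) (by simpa using hs)).mono ?_
    rintro p (hp | hp)
    · exact Or.inl (Or.inr hp)
    · rcases List.mem_cons.1 hp with rfl | hp
      · exact Or.inl (Or.inl rfl)
      · exact Or.inr hp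

/-- The sequence of answers to a play. -/
def respondPlay (e : ℕ → Set (A × B) → A → B) {k : ℕ} (s : Play k A) : Play k B :=
  ⟨respond e k ∅ s.1, by
    have := s.length_pos
    rw [← List.length_pos_iff_ne_nil, length_respond]
    exact ⟨this, s.2.2⟩⟩

/-- Answers depend only on the moves made so far, so coextension recovers the whole sequence of
answers; composing coKleisli morphisms thus composes strategies. -/
theorem coext_last_respondPlay (e : ℕ → Set (A × B) → A → B) {k : ℕ} (s : Play k A) :
    Play.coext (fun t => (respondPlay e t).last) s = respondPlay e s := by
  apply Subtype.ext
  apply List.ext_getElem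
  · simp [respondPlay]
  · intro i h1 h2
    simp only [Play.coext, List.getElem_ofFn]
    have h3 : i < s.1.length := by simpa using h1
    have : respondPlay e (s.init ⟨i, h3⟩) = (respondPlay e s).init ⟨i, h2⟩ := by
      apply Subtype.ext
      simp only [respondPlay, Play.init, respond_take]
    rw [this]
    exact Play.init_last _ _

theorem last_respondPlay_coext {e : ℕ → Set (A × B) → A → B} {e' : ℕ → Set (B × A) → B → A}
    {k : ℕ} (s : Play k A) (h : respond e' k ∅ (respond e k ∅ s.1) = s.1) :
    (respondPlay e' (Play.coext (fun t => (respondPlay e t).last) s)).last = s.last := by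
  rw [coext_last_respondPlay]
  congr 1
  exact Subtype.ext h

theorem Play.exists_prefix {k m : ℕ} (s : Fin m → Play k A)
    (hs : ∀ i j, (s i).1 <+: (s j).1 ∨ (s j).1 <+: (s i).1) :
    ∃ t : List A, t.length ≤ k ∧ ∀ i, (s i).1 <+: t := by
  cases m with
  -- A nullary relation offers no longest play; hence `t` is a list, possibly empty.
  | zero => exact ⟨[], by simp, fun i => i.elim0⟩
  | succ m =>
    obtain ⟨i, hi⟩ := Finite.exists_max fun i => (s i).1.length
    refine ⟨(s i).1, (s i).2.2, fun j => (hs j i).elim id fun h => ?_⟩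
    rw [h.eq_of_length_le (hi j)]

theorem last_mem_zip_respond (e : ℕ → Set (A × B) → A → B) {k : ℕ} (s : Play k A) {t : List A}
    (h : s.1 <+: t) : (s.last, (respondPlay e s).last) ∈ t.zip (respond e k ∅ t) := by
  have hpos := s.length_pos
  have hle := h.length_le
  have hs : s.1 = t.take s.1.length := List.prefix_iff_eq_take.1 h
  have hr : respond e k ∅ s.1 = (respond e k ∅ t).take s.1.length := by
    rw [← respond_take, ← hs]
  rw [List.mem_iff_getElem]
  refine ⟨s.1.length - 1, by simp; omega, ?_⟩
  rw [List.getElem_zip, Play.last_eq, Play.last_eq]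
  simp only [respondPlay, length_respond, Prod.mk.injEq]
  constructor
  · rw [h.getElem]
  · rw [(List.prefix_iff_eq_take.2 (by simpa using hr) : respond e k ∅ s.1 <+: _).getElem]

end Strategies

/-! ### Existential strategies and coKleisli morphisms -/

section Morphisms

variable {σ : FirstOrder.Language.{u, u}} [σ.IsRelational] {k : ℕ} {A B : RelStr σ}

/-- A winning strategy for the existential game gives a coKleisli morphism. -/
def homOfStrategy {W : ℕ → Set (A.carrier × B.carrier) → Prop}
    {e : ℕ → Set (A.carrier × B.carrier) → A.carrier → B.carrier}
    (hW : ∀ j S, W j S → PartialHom σ S)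
    (he : ∀ j S, W (j + 1) S → ∀ a, W j (insert (a, e (j + 1) S a) S)) (h : W k ∅) :
    (⟨A⟩ : EFPlus σ k) ⟶ ⟨B⟩ :=
  let f : (EF (plus σ) k).obj (plusObj A) ⟶ plusObj B :=
    { toFun := fun s : Play k A.carrier => (respondPlay e s).last
      map_fun' := fun f _ => isEmptyElim f
      map_rel' := fun {m} R (s : Fin m → Play k A.carrier) hs => by
        -- Comparable plays are stages of a single play `t`, so all the relevant pairs lie in one
        -- legal position.
        obtain ⟨t, htk, ht⟩ := Play.exists_prefix s hs.1
        have hg : PartialHom σ (∅ ∪ {p | p ∈ t.zip (respond e k ∅ t)}) :=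
          partialHom_respond hW he t h htk
        have hmem : ∀ i, ((s i).last, (respondPlay e (s i)).last) ∈
            (∅ ∪ {p | p ∈ t.zip (respond e k ∅ t)} : Set (A.carrier × B.carrier)) :=
          fun i => Or.inr (last_mem_zip_respond e (s i) (ht i))
        rcases R with R | R
        · exact hg.2 R (fun i => ((s i).last, (respondPlay e (s i)).last)) hmem hs.2
        · cases R
          exact hg.1 _ (hmem 0) _ (hmem 1) hs.2 }
  f

/-- A coKleisli morphism for `E_k^+` is a homomorphism of `σ`-structures. -/
def homOfPlus (f : (⟨A⟩ : EFPlus σ k) ⟶ ⟨B⟩) : (EF σ k).obj A ⟶ B :=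
  let f' : (EF (plus σ) k).obj (plusObj A) ⟶ plusObj B := f
  { toFun := f'.toFun
    map_fun' := fun f _ => isEmptyElim f
    map_rel' := fun R s hs => f'.map_rel' (Sum.inl R) s hs }

theorem nonempty_hom_of_sim (hk : 0 < k) (h : Sim (A := A.carrier) (B := B.carrier) σ k ∅) :
    Nonempty ((⟨A⟩ : EFPlus σ k) ⟶ ⟨B⟩) := by
  obtain ⟨k, rfl⟩ := Nat.exists_eq_add_one.2 hk
  have H : ∀ (j : ℕ) (S : Set (A.carrier × B.carrier)) (a : A.carrier),
      ∃ b : B.carrier, Sim σ j S → ∀ i, j = i + 1 → Sim σ i (insert (a, b) S) := by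
    intro j S a
    -- A default answer for lost positions; it exists because at least one round is played.
    obtain ⟨b₀, -⟩ := h.2 a
    by_cases hS : ∃ i, j = i + 1 ∧ Sim σ j S
    · obtain ⟨i, rfl, hi⟩ := hS
      obtain ⟨b, hb⟩ := hi.2 a
      refine ⟨b, fun _ i' hi' => ?_⟩
      obtain rfl : i = i' := by omega
      exact hb
    · exact ⟨b₀, fun h1 i hi => absurd ⟨i, hi, h1⟩ hS⟩
  choose e he using H
  exact ⟨homOfStrategy (fun _ _ h => h.partialHom) (fun j S hS a => he _ _ _ hS j rfl) h⟩

theorem sim_of_hom (f : (EF σ k).obj A ⟶ B) : Sim (A := A.carrier) (B := B.carrier) σ k ∅ := by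
  let F : Play k A.carrier → B.carrier := f.toFun
  -- Only fresh moves are recorded in `s`, whence `≤`. Without repetitions a prefix of `s` is
  -- determined by its last element, so the position is functional although `f` need not respect
  -- `I`.
  have key : ∀ (j : ℕ) (s : List A.carrier), s.Nodup → j + s.length ≤ k →
      Sim σ j {p | ∃ t : Play k A.carrier, t.1 <+: s ∧ p = (t.last, F t)} := by
    have base : ∀ s : List A.carrier, s.Nodup →
        PartialHom σ {p | ∃ t : Play k A.carrier, t.1 <+: s ∧ p = (t.last, F t)} := by
      intro s hs
      constructor
      · rintro _ ⟨t, ht, rfl⟩ _ ⟨t', ht', rfl⟩ heq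
        have h1 := t.length_pos
        have h2 := t'.length_pos
        have h3 := ht.length_le
        have h4 := ht'.length_le
        simp only [Play.last_eq, ht.getElem, ht'.getElem] at heq
        rw [hs.getElem_inj_iff] at heq
        have : t = t' := by
          apply Subtype.ext
          rw [List.prefix_iff_eq_take.1 ht, List.prefix_iff_eq_take.1 ht']
          congr 1
          omega
        rw [this]
      · intro m R p hp hR
        choose t ht htp using hp
        obtain rfl : p = fun i => ((t i).last, F (t i)) := funext htp
        exact f.map_rel' R t ⟨fun i j => List.prefix_or_prefix_of_prefix (ht i) (ht j), hR⟩
    intro j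
    induction j with
    | zero => exact fun s hs _ => base s hs
    | succ j ih =>
      intro s hs hjs
      refine ⟨base s hs, fun a => ?_⟩
      by_cases ha : a ∈ s
      · obtain ⟨i, hi, rfl⟩ := List.mem_iff_getElem.1 ha
        let s' : Play k A.carrier := ⟨s, List.ne_nil_of_mem ha, by omega⟩
        -- Repeating the answer given when `s[i]` was first played leaves the position unchanged.
        refine ⟨F (s'.init ⟨i, hi⟩), ?_⟩
        rw [Set.insert_eq_of_mem]
        · exact ih s hs (by omega)
        · exact ⟨s'.init ⟨i, hi⟩, List.take_prefix _ _, by rw [Play.init_last]⟩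
      · let s' : Play k A.carrier := ⟨s ++ [a], by simp, by simp; omega⟩
        refine ⟨F s', ?_⟩
        convert ih (s ++ [a]) (List.nodup_append.2 ⟨hs, by simp, by
          simp only [List.mem_singleton]
          rintro x hx _ rfl rfl
          exact ha hx⟩) (by simp; omega) using 1
        ext p
        simp only [Set.mem_insert_iff, Set.mem_ofPred_eq, List.prefix_concat_iff]
        constructor
        · rintro (rfl | ⟨t, ht, rfl⟩)
          · exact ⟨s', Or.inl rfl, by simp [s', Play.last]⟩
          · exact ⟨t, Or.inr ht, rfl⟩
        · rintro ⟨t, ht | ht, rfl⟩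
          · left
            obtain rfl : t = s' := Subtype.ext ht
            simp [s', Play.last]
          · exact Or.inr ⟨t, ht, rfl⟩
  convert key k [] List.nodup_nil (by simp)
  ext p
  simp only [Set.mem_empty_iff_false, Set.mem_ofPred_eq, List.prefix_nil, false_iff]
  rintro ⟨t, ht, -⟩
  exact t.2.1 ht

end Morphisms
end GameComonad

namespace GameComonad

open FirstOrder.Language.Structure

/-! ### Plays extended by one move -/

section Snoc

variable {k : ℕ} {X Y : Type u}

/-- The play that continues the sequence `s` with the move `a`. -/
def Play.snoc (s : List X) (a : X) (h : s.length < k) : Play k X :=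
  ⟨s ++ [a], by simp, by simpa using h⟩

@[simp] theorem Play.last_snoc (s : List X) (a : X) (h : s.length < k) :
    (Play.snoc s a h).last = a := by
  simp [Play.snoc, Play.last]

theorem Play.coext_snoc_congr (f : Play k X → Y) (s : List X) {a a' : X}
    (h : s.length < k) (haa : f (Play.snoc s a h) = f (Play.snoc s a' h)) :
    Play.coext f (Play.snoc s a h) = Play.coext f (Play.snoc s a' h) := by
  apply Subtype.ext
  apply List.ext_getElem
  · rw [Play.length_coext, Play.length_coext]
    simp [Play.snoc]
  · intro i h1 h2
    simp only [Play.coext, List.getElem_ofFn]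
    rw [Play.length_coext] at h1
    have h3 : i < s.length + 1 := by simpa [Play.snoc] using h1
    rcases Nat.lt_succ_iff_lt_or_eq.1 h3 with hi | rfl
    · congr 1
      apply Subtype.ext
      simp only [Play.init, Play.snoc]
      rw [List.take_append_of_le_length hi, List.take_append_of_le_length hi]
    · convert haa using 2 <;>
      · apply Subtype.ext
        simp only [Play.init, Play.snoc]
        rw [List.take_of_length_le (by simp)]

/-- If two last moves get the same answer, the coextended plays coincide, and `g` recovers both
moves from them. -/
theorem injective_snoc {f : Play k X → Y} {g : Play k Y → X}
    (hgf : ∀ s, g (Play.coext f s) = s.last) (s : List X) (h : s.length < k) :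
    Function.Injective fun a => f (Play.snoc s a h) := by
  intro a a' haa
  have := congrArg g (Play.coext_snoc_congr f s h haa)
  simpa [hgf] using this

end Snoc

/-! ### Bijection strategies and coKleisli isomorphisms -/

section Isomorphisms

variable {σ : FirstOrder.Language.{u, u}} [σ.IsRelational] {k : ℕ} {A B : RelStr σ}

theorem nonempty_iso_of_bijSim (hk : 0 < k)
    (h : BijSim (A := A.carrier) (B := B.carrier) σ k ∅) :
    Nonempty ((⟨A⟩ : EFPlus σ k) ≅ ⟨B⟩) := by
  obtain ⟨k, rfl⟩ := Nat.exists_eq_add_one.2 hk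
  obtain ⟨e₀, -⟩ := h.2
  have H : ∀ (j : ℕ) (S : Set (A.carrier × B.carrier)), ∃ e : A.carrier ≃ B.carrier,
      BijSim σ j S → ∀ i, j = i + 1 → ∀ a, BijSim σ i (insert (a, e a) S) := by
    intro j S
    by_cases hS : ∃ i, j = i + 1 ∧ BijSim σ j S
    · obtain ⟨i, rfl, hi⟩ := hS
      obtain ⟨e, he⟩ := hi.2
      refine ⟨e, fun _ i' hi' => ?_⟩
      obtain rfl : i = i' := by omega
      exact he
    · exact ⟨e₀, fun h1 i hi => absurd ⟨i, hi, h1⟩ hS⟩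
  choose e he using H
  let f : (⟨A⟩ : EFPlus σ (k + 1)) ⟶ ⟨B⟩ := homOfStrategy (W := BijSim σ)
    (e := fun j S => e j S) (fun _ _ h => h.partialHom.1) (fun j S hS a => he _ _ hS j rfl a) h
  -- The inverse bijections, played on mirrored positions, undo `f` move by move.
  let g : (⟨B⟩ : EFPlus σ (k + 1)) ⟶ ⟨A⟩ := homOfStrategy
    (W := fun j T => BijSim σ j (Prod.swap ⁻¹' T))
    (e := fun j T => (e j (Prod.swap ⁻¹' T)).symm) (fun _ _ h => h.partialHom.2)
    (fun j T hT b => by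
      have := he _ _ hT j rfl ((e (j + 1) (Prod.swap ⁻¹' T)).symm b)
      rwa [Equiv.apply_symm_apply, ← preimage_swap_insert] at this) h
  exact ⟨⟨f, g,
    RelStr.hom_ext fun s : Play (k + 1) A.carrier =>
      last_respondPlay_coext s (respond_symm_respond e (k + 1) ∅ s.1),
    RelStr.hom_ext fun s : Play (k + 1) B.carrier =>
      last_respondPlay_coext s (respond_respond_symm e (k + 1) ∅ s.1)⟩⟩

/-- Preservation of `I` makes the answers along a chain of plays depend only on the last element,
even when moves repeat. -/
theorem partialHom_of_plusHom (f : (EF (plus σ) k).obj (plusObj A) ⟶ plusObj B)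
    {C : Set (Play k A.carrier)} (hC : ∀ s ∈ C, ∀ t ∈ C, s.1 <+: t.1 ∨ t.1 <+: s.1) :
    PartialHom (A := A.carrier) (B := B.carrier) σ ((fun t => (t.last, f.toFun t)) '' C) := by
  constructor
  · rintro _ ⟨s, hs, rfl⟩ _ ⟨t, ht, rfl⟩ h
    refine f.map_rel' (Sum.inr IdRel.I) ![s, t] ⟨?_, h⟩
    have hmem : ∀ i, (![s, t] : Fin 2 → Play k A.carrier) i ∈ C := by
      intro i
      fin_cases i
      exacts [hs, ht]
    exact fun i j => hC _ (hmem i) _ (hmem j)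
  · intro m R p hp hR
    choose s hs hsp using hp
    obtain rfl : (fun i => ((s i).last, f.toFun (s i))) = p := funext hsp
    exact f.map_rel' (Sum.inl R) s ⟨fun i j => hC _ (hs i) _ (hs j), hR⟩

theorem bijSim_of_iso (hk : 0 < k) [Finite A.carrier] [Finite B.carrier]
    (i : (⟨A⟩ : EFPlus σ k) ≅ ⟨B⟩) : BijSim (A := A.carrier) (B := B.carrier) σ k ∅ := by
  let f : (EF (plus σ) k).obj (plusObj A) ⟶ plusObj B := i.hom
  let g : (EF (plus σ) k).obj (plusObj B) ⟶ plusObj A := i.inv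
  let F : Play k A.carrier → B.carrier := f.toFun
  let G : Play k B.carrier → A.carrier := g.toFun
  have hgf : ∀ s, G (Play.coext F s) = s.last := fun s =>
    congrArg (fun φ : (EF (plus σ) k).obj (plusObj A) ⟶ plusObj A => φ.toFun s) i.hom_inv_id
  have hfg : ∀ s, F (Play.coext G s) = s.last := fun s =>
    congrArg (fun φ : (EF (plus σ) k).obj (plusObj B) ⟶ plusObj B => φ.toFun s) i.inv_hom_id
  -- The opening answers of `G` inject `B` into `A`; this later makes the injections given by `F`
  -- bijective.
  have hcard : Nat.card B.carrier ≤ Nat.card A.carrier :=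
    Nat.card_le_card_of_injective _ (injective_snoc (k := k) (f := G) (g := F) hfg [] hk)
  let pos (s : List A.carrier) : Set (A.carrier × B.carrier) :=
    (fun t => (t.last, F t)) '' {t : Play k A.carrier | t.1 <+: s}
  have base : ∀ s, PartialHom σ (pos s) ∧ PartialHom σ (Prod.swap ⁻¹' pos s) := by
    intro s
    -- The mirrored position comes from `g` along the chain of coextended plays, whose last elements
    -- are the answers of `F` and on which `G` returns the original moves.
    refine ⟨partialHom_of_plusHom f
        fun t ht t' ht' => List.prefix_or_prefix_of_prefix ht ht',
      (partialHom_of_plusHom g (C := Play.coext F '' {t | t.1 <+: s}) ?_).mono ?_⟩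
    · rintro _ ⟨t, ht, rfl⟩ _ ⟨t', ht', rfl⟩
      exact (List.prefix_or_prefix_of_prefix ht ht').imp
        (Play.coext_prefix F) (Play.coext_prefix F)
    · rintro ⟨b, a⟩ ⟨t, ht, hta⟩
      refine ⟨_, ⟨t, ht, rfl⟩, ?_⟩
      rw [← show (t.last, F t).swap = (b, a) from congrArg Prod.swap hta]
      exact Prod.ext (Play.last_coext F t) (hgf t)
  -- Repeated moves are recorded too, so `s` grows in every round.
  have key : ∀ (j : ℕ) (s : List A.carrier), j + s.length = k → BijSim σ j (pos s) := by
    intro j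
    induction j with
    | zero => exact fun s _ => base s
    | succ j ih =>
      intro s hs
      have hsk : s.length < k := by omega
      refine ⟨base s, Equiv.ofBijective _
        ((injective_snoc hgf s hsk).bijective_of_nat_card_le hcard), fun a => ?_⟩
      convert ih (s ++ [a]) (by simp; omega) using 1
      ext p
      simp only [pos, Set.mem_insert_iff, Set.mem_image, Set.mem_ofPred_eq,
        List.prefix_concat_iff, Equiv.ofBijective_apply]
      constructor
      · rintro (rfl | ⟨t, ht, rfl⟩)
        · exact ⟨Play.snoc s a hsk, Or.inl rfl, by simp⟩
        · exact ⟨t, Or.inr ht, rfl⟩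
      · rintro ⟨t, ht | ht, rfl⟩
        · left
          obtain rfl : t = Play.snoc s a hsk := Subtype.ext ht
          simp
        · exact Or.inr ⟨t, ht, rfl⟩
  convert key k [] (by simp)
  symm
  rw [Set.image_eq_empty]
  exact Set.eq_empty_of_forall_notMem fun t ht => t.2.1 (List.prefix_nil.1 ht)

end Isomorphisms

/-! ### From the games to the two equivalences -/

section Equivalences

variable {σ : FirstOrder.Language.{u, u}} {k : ℕ} {A B : RelStr σ}

theorem range_elim0_pair {X Y : Type u} :
    (Set.range fun i => ((Fin.elim0 i : X), (Fin.elim0 i : Y))) = ∅ :=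
  Set.range_eq_empty _

theorem sim_of_models {L : Set (Fml σ 0)} (hL : ∀ i : GameIndex σ 0 k, gameFml i ∈ L)
    (h : ∀ φ ∈ L, Models A φ → Models B φ) :
    Sim (A := A.carrier) (B := B.carrier) σ k ∅ := by
  rw [← range_elim0_pair]
  exact sim_of_gameFml fun i => h _ (hL i)

theorem models_of_sim (h : Sim (A := A.carrier) (B := B.carrier) σ k ∅) {φ : Fml σ 0}
    (hφ : φ ∈ exPosLogic σ k) : Models A φ → Models B φ := by
  rw [← range_elim0_pair] at h
  exact h.realize φ hφ.2 hφ.1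

theorem equivalent_iff_sim {L : Set (Fml σ 0)} (hL : ∀ i : GameIndex σ 0 k, gameFml i ∈ L)
    (hL' : L ⊆ exPosLogic σ k) : Equivalent L A B ↔
      Sim (A := A.carrier) (B := B.carrier) σ k ∅ ∧
        Sim (A := B.carrier) (B := A.carrier) σ k ∅ :=
  ⟨fun h => ⟨sim_of_models hL fun φ hφ => (h φ hφ).1, sim_of_models hL fun φ hφ => (h φ hφ).2⟩,
    fun h _ hφ => ⟨models_of_sim h.1 (hL' hφ), models_of_sim h.2 (hL' hφ)⟩⟩

theorem nonempty_plusHom_iff_sim [σ.IsRelational] (hk : 0 < k) :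
    Nonempty ((⟨A⟩ : EFPlus σ k) ⟶ ⟨B⟩) ↔ Sim (A := A.carrier) (B := B.carrier) σ k ∅ :=
  ⟨fun ⟨f⟩ => sim_of_hom (homOfPlus f), nonempty_hom_of_sim hk⟩

theorem nonempty_hom_iff_sim [σ.IsRelational] (hk : 0 < k) :
    Nonempty ((EF σ k).obj A ⟶ B) ↔ Sim (A := A.carrier) (B := B.carrier) σ k ∅ :=
  ⟨fun ⟨f⟩ => sim_of_hom f, fun h => (nonempty_hom_of_sim hk h).map homOfPlus⟩

/-- Finitary sentences already yield the strategy and a strategy preserves infinitary ones, so any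
logic in between will do. -/
theorem equivalent_counting_iff [σ.IsRelational] (hk : 0 < k) [Finite A.carrier]
    [Finite B.carrier] {L : Set (Fml σ 0)} (hL : countingLogicFO σ k ⊆ L)
    (hL' : L ⊆ countingLogic σ k) :
    Equivalent L A B ↔ Nonempty ((⟨A⟩ : EFPlus σ k) ≅ ⟨B⟩) := by
  constructor
  · intro h
    apply nonempty_iso_of_bijSim hk
    rw [← range_elim0_pair]
    exact bijSim_of_realize_iff fun φ hr hf => h φ (hL ⟨hr, hf⟩)
  · rintro ⟨i⟩ φ hφ
    have h := bijSim_of_iso hk i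
    rw [← range_elim0_pair] at h
    exact h.realize_iff φ (hL' hφ)

end Equivalences

end GameComonad

theorem mainTheorem1 (σ : FirstOrder.Language.{u, u}) [σ.IsRelational] (k : ℕ) (hk : 0 < k) :
    (∀ A B : GameComonad.RelStr σ,
      (GameComonad.Equivalent (GameComonad.exPosLogic σ k) A B ↔
        Nonempty ((GameComonad.EF σ k).obj A ⟶ B) ∧
          Nonempty ((GameComonad.EF σ k).obj B ⟶ A)) ∧
      (GameComonad.Equivalent (GameComonad.exPosLogic σ k) A B ↔
        Nonempty ((⟨A⟩ : GameComonad.EFPlus σ k) ⟶ ⟨B⟩) ∧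
          Nonempty ((⟨B⟩ : GameComonad.EFPlus σ k) ⟶ ⟨A⟩)) ∧
      (Finite (Σ n, σ.Relations n) →
        (GameComonad.Equivalent (GameComonad.exPosLogicFO σ k) A B ↔
          Nonempty ((GameComonad.EF σ k).obj A ⟶ B) ∧
            Nonempty ((GameComonad.EF σ k).obj B ⟶ A)))) ∧
    (∀ A B : GameComonad.RelStr σ, Finite A.carrier → Finite B.carrier →
      (GameComonad.Equivalent (GameComonad.countingLogic σ k) A B ↔
        Nonempty ((⟨A⟩ : GameComonad.EFPlus σ k) ≅ ⟨B⟩)) ∧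
      (GameComonad.Equivalent (GameComonad.countingLogicFO σ k) A B ↔
        Nonempty ((⟨A⟩ : GameComonad.EFPlus σ k) ≅ ⟨B⟩))) := by
  refine ⟨fun A B => ?_, fun A B _ _ => ?_⟩
  · rw [GameComonad.nonempty_hom_iff_sim hk, GameComonad.nonempty_hom_iff_sim hk,
      GameComonad.nonempty_plusHom_iff_sim hk, GameComonad.nonempty_plusHom_iff_sim hk]
    have h := GameComonad.equivalent_iff_sim (A := A) (B := B) (L := GameComonad.exPosLogic σ k)
      (fun i => ⟨GameComonad.rank_gameFml i, GameComonad.exPos_gameFml i⟩) subset_rfl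
    exact ⟨h, h, fun _ => GameComonad.equivalent_iff_sim
      (fun i => ⟨GameComonad.rank_gameFml i, GameComonad.exPos_gameFml i,
        GameComonad.finitary_gameFml i⟩) fun φ hφ => ⟨hφ.1, hφ.2.1⟩⟩
  · exact ⟨GameComonad.equivalent_counting_iff hk (fun φ hφ => hφ.1) subset_rfl,
      GameComonad.equivalent_counting_iff hk subset_rfl (fun φ hφ => hφ.1)⟩
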